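/- Let $n \ge 1$ and let $M$ be a compact complex manifold with $C^\infty$ boundary, $\dim_{\mathbb C} M = n$; that is, $M$ is a compact Hausdorff smooth real $2n$-dimensional manifold with (possibly empty) boundary $\partial M$, with an almost complex structure $J$ that is smooth up to $\partial M$ and is induced, near every interior point, by complex coordinate systems. $M$ need not be connected. Let $C^\infty(M)$ be the space of complex-valued functions smooth up to the boundary, and let \[ \mathcal O(M) = \{ f \in C^\infty(M) : f \text{ is holomorphic in } M^{\mathrm{int}} \}. \] Assume that (a) $M$ is holomorphically separable: for all $x \ne y$ in $M$ there is $f \in \mathcal O(M)$ with $f(x) \neq f(y)$; (b) $M$ has local charts given by global holomorphic functions: for every $p \in M$ (boundary points included) there are $f_1,\dots,f_n \in \mathcal O(M)$ which form a complex coordinate system near $p$. Let $g$ be any Kähler metric on $M$, i.e. a Riemannian metric, smooth up to the boundary, with $g(Jv,Jw) = g(v,w)$ for all tangent vectors $v,w$ and $\nabla J = 0$ for the Levi-Civita connection $\nabla$ of $g$. Let $\Delta_g$ be its Laplace–Beltrami operator and $dV_g$ its Riemannian volume measure. If $f \in C^\infty(M)$ vanishes to infinite order at $\partial M$ (all derivatives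 of all orders $\ge 0$ vanish at every point of $\partial M$) and \[ \int_M f u_1 u_2 \, dV_g = 0 \] for all $u_1, u_2 \in C^\infty(M)$ satisfying $\Delta_g u_1 = \Delta_g u_2 = 0$ in $M$, then $f \equiv 0$. -/

import Mathlib

open MeasureTheory Set
open scoped Manifold ContDiff Topology Bundle

noncomputable section

namespace KahlerCalderon

variable {n : ℕ} [NeZero n] {M : Type*} [TopologicalSpace M]
  [ChartedSpace (EuclideanHalfSpace (2 * n)) M]

/-- The `i`-th standard basis vector of `ℝ²ⁿ`. -/
abbrev stdVec (n : ℕ) (i : Fin (2 * n)) : EuclideanSpace ℝ (Fin (2 * n)) :=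
  EuclideanSpace.single i 1

/-- The `i`-th partial derivative, at the point `y` of the closed half-space, of a function on the
closed half-space of `ℝ²ⁿ` (at boundary points of the half-space this is the derivative from
inside). -/
def partialDeriv (n : ℕ) [NeZero n] {F : Type*} [NormedAddCommGroup F] [NormedSpace ℝ F]
    (i : Fin (2 * n)) (u : EuclideanSpace ℝ (Fin (2 * n)) → F)
    (y : EuclideanSpace ℝ (Fin (2 * n))) : F :=
  fderivWithin ℝ u (range (𝓡∂ (2 * n))) y (stdVec n i)

/-- The differential at `p` of a function on `M` with values in a real vector space `F`. -/
def differential {F : Type*} [NormedAddCommGroup F] [NormedSpace ℝ F] (u : M → F) (p : M) :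
    TangentSpace (𝓡∂ (2 * n)) p →L[ℝ] F :=
  mfderiv (𝓡∂ (2 * n)) 𝓘(ℝ, F) u p

/-- Complex-valued functions that are smooth up to the boundary. -/
def Smooth (n : ℕ) [NeZero n] {M : Type*} [TopologicalSpace M]
    [ChartedSpace (EuclideanHalfSpace (2 * n)) M] (u : M → ℂ) : Prop :=
  ContMDiff (𝓡∂ (2 * n)) 𝓘(ℝ, ℂ) ∞ u

/-! ### Complex structures on manifolds with boundary -/

/-- For a field `J` of endomorphisms of the (real) tangent spaces, `z = (z₁, …, zₙ)` is a complex
coordinate system on the open set `U`: the map `z : U → ℂⁿ` is smooth (up to the boundary),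
injective, has bijective real differential at each point, and satisfies the Cauchy–Riemann
equations `dz ∘ J = i dz`. -/
structure IsComplexChartOn (J : ∀ p : M, TangentSpace (𝓡∂ (2 * n)) p →L[ℝ]
    TangentSpace (𝓡∂ (2 * n)) p) (z : M → (Fin n → ℂ)) (U : Set M) : Prop where
  isOpen : IsOpen U
  smooth : ContMDiffOn (𝓡∂ (2 * n)) 𝓘(ℝ, Fin n → ℂ) ∞ z U
  injOn : InjOn z U
  bijective : ∀ q ∈ U, Function.Bijective (differential (n := n) z q)
  cauchyRiemann : ∀ q ∈ U, ∀ v : TangentSpace (𝓡∂ (2 * n)) q,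
    differential z q (J q v) = Complex.I • differential z q v

/-- A complex structure on the smooth real `2n`-dimensional manifold with boundary `M`: the
canonical almost complex structure `J`, smooth up to the boundary, such that the interior is
covered by complex coordinate systems. (Two such coordinate systems differ by a map whose
differential commutes with `i`, that is by a holomorphic map.) Complex coordinates near boundary
points are not required. -/
structure ComplexStructure (n : ℕ) [NeZero n] (M : Type*) [TopologicalSpace M]
    [ChartedSpace (EuclideanHalfSpace (2 * n)) M] [IsManifold (𝓡∂ (2 * n)) ∞ M] where
  J : ∀ p : M, TangentSpace (𝓡∂ (2 * n)) p →L[ℝ] TangentSpace (𝓡∂ (2 * n)) p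
  J_sq : ∀ (p : M) (v : TangentSpace (𝓡∂ (2 * n)) p), J p (J p v) = -v
  smooth : ContMDiff (𝓡∂ (2 * n))
    ((𝓡∂ (2 * n)).prod 𝓘(ℝ, EuclideanSpace ℝ (Fin (2 * n)) →L[ℝ] EuclideanSpace ℝ (Fin (2 * n))))
    ∞ (fun p : M ↦ Bundle.TotalSpace.mk'
      (E := fun p : M ↦ TangentSpace (𝓡∂ (2 * n)) p →L[ℝ] TangentSpace (𝓡∂ (2 * n)) p)
      (EuclideanSpace ℝ (Fin (2 * n)) →L[ℝ] EuclideanSpace ℝ (Fin (2 * n))) p (J p))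
  exists_chart : ∀ p ∈ (𝓡∂ (2 * n)).interior M, ∃ (z : M → (Fin n → ℂ)) (U : Set M),
    p ∈ U ∧ IsComplexChartOn J z U

section complex

variable [IsManifold (𝓡∂ (2 * n)) ∞ M]

/-- The algebra `𝒪(M)`: functions smooth up to the boundary which are holomorphic in the interior,
i.e. satisfy the Cauchy–Riemann equations `df ∘ J = i df` there. -/
def ComplexStructure.holomorphicFunctions (S : ComplexStructure n M) : Set (M → ℂ) :=
  {f | Smooth n f ∧ ∀ p ∈ (𝓡∂ (2 * n)).interior M, ∀ v : TangentSpace (𝓡∂ (2 * n)) p,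
    differential f p (S.J p v) = Complex.I * differential f p v}

/-- Global holomorphic functions separate points. -/
def ComplexStructure.HolomorphicallySeparable (S : ComplexStructure n M) : Prop :=
  ∀ x y : M, x ≠ y → ∃ f ∈ S.holomorphicFunctions, f x ≠ f y

/-- Near every point (boundary points included) some `n` global holomorphic functions form a
complex coordinate system. -/
def ComplexStructure.HasGlobalHolomorphicCharts (S : ComplexStructure n M) : Prop :=
  ∀ p : M, ∃ f : Fin n → M → ℂ, (∀ j, f j ∈ S.holomorphicFunctions) ∧
    ∃ U : Set M, p ∈ U ∧ IsComplexChartOn S.J (fun q j ↦ f j q) U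

end complex

/-! ### Riemannian metrics in coordinates -/

section metric

variable [IsManifold (𝓡∂ (2 * n)) ∞ M]

variable (n M) in
/-- Riemannian metrics on `M`, smooth up to the boundary. -/
abbrev Metric : Type _ :=
  Bundle.ContMDiffRiemannianMetric (𝓡∂ (2 * n)) ∞ (EuclideanSpace ℝ (Fin (2 * n)))
    (fun p : M ↦ TangentSpace (𝓡∂ (2 * n)) p)

/-- The coordinate vector field `∂/∂xᵢ` of the preferred chart around `p`, at the point with
coordinates `y`. -/
def coordVec (p : M) (y : EuclideanSpace ℝ (Fin (2 * n))) (i : Fin (2 * n)) :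
    TangentSpace (𝓡∂ (2 * n)) ((extChartAt (𝓡∂ (2 * n)) p).symm y) :=
  mfderivWithin 𝓘(ℝ, EuclideanSpace ℝ (Fin (2 * n))) (𝓡∂ (2 * n))
    (extChartAt (𝓡∂ (2 * n)) p).symm (range (𝓡∂ (2 * n))) y (stdVec n i)

/-- The matrix `gᵢⱼ = g(∂/∂xᵢ, ∂/∂xⱼ)` in the preferred chart around `p`. -/
def metricCoord (g : Metric n M) (p : M) (y : EuclideanSpace ℝ (Fin (2 * n))) :
    Matrix (Fin (2 * n)) (Fin (2 * n)) ℝ :=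
  Matrix.of fun i j ↦ g.inner ((extChartAt (𝓡∂ (2 * n)) p).symm y) (coordVec p y i) (coordVec p y j)

/-- The Christoffel symbol `Γᵏᵢⱼ` of the Levi-Civita connection of `g` in the preferred chart
around `p`. -/
def christoffel (g : Metric n M) (p : M) (k i j : Fin (2 * n))
    (y : EuclideanSpace ℝ (Fin (2 * n))) : ℝ :=
  (1 / 2) * ∑ l, (metricCoord g p y)⁻¹ k l *
    (partialDeriv n i (fun x ↦ metricCoord g p x j l) y +
      partialDeriv n j (fun x ↦ metricCoord g p x i l) y -
      partialDeriv n l (fun x ↦ metricCoord g p x i j) y)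

/-- The components `Jᵏⱼ` of the almost complex structure in the preferred chart around `p`:
`J(∂/∂xⱼ) = ∑ₖ Jᵏⱼ ∂/∂xₖ`. -/
def complexCoord (S : ComplexStructure n M) (p : M) (k j : Fin (2 * n))
    (y : EuclideanSpace ℝ (Fin (2 * n))) : ℝ :=
  differential (extChartAt (𝓡∂ (2 * n)) p) ((extChartAt (𝓡∂ (2 * n)) p).symm y)
    (S.J ((extChartAt (𝓡∂ (2 * n)) p).symm y) (coordVec p y j)) k

/-- The components `(∇ᵢ J)ᵏⱼ` of the Levi-Civita covariant derivative of `J` in the preferred chart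
around `p`. -/
def covDerivJ (S : ComplexStructure n M) (g : Metric n M) (p : M) (i k j : Fin (2 * n))
    (y : EuclideanSpace ℝ (Fin (2 * n))) : ℝ :=
  partialDeriv n i (complexCoord S p k j) y +
    ∑ l, (christoffel g p k i l y * complexCoord S p l j y -
      christoffel g p l i j y * complexCoord S p k l y)

/-- `g` is a Kähler metric: it is compatible with `J`, and `∇J = 0` for its Levi-Civita
connection. -/
structure IsKahler (S : ComplexStructure n M) (g : Metric n M) : Prop where
  compatible : ∀ (p : M) (v w : TangentSpace (𝓡∂ (2 * n)) p),
    g.inner p (S.J p v) (S.J p w) = g.inner p v w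
  parallel : ∀ (p : M) (i k j : Fin (2 * n)),
    covDerivJ S g p i k j (extChartAt (𝓡∂ (2 * n)) p p) = 0

/-- The (positive) Laplace–Beltrami operator
`Δ_g u = - |g|^{-1/2} ∑ᵢⱼ ∂ᵢ (|g|^{1/2} gⁱʲ ∂ⱼ u)`, at `p` computed in the preferred chart around
`p`. -/
def laplacian (g : Metric n M) (u : M → ℂ) (p : M) : ℂ :=
  -(((√(metricCoord g p (extChartAt (𝓡∂ (2 * n)) p p)).det)⁻¹ : ℝ) : ℂ) *
    ∑ i, ∑ j, partialDeriv n i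
      (fun y ↦ ((√(metricCoord g p y).det * (metricCoord g p y)⁻¹ i j : ℝ) : ℂ) *
        partialDeriv n j (fun x ↦ u ((extChartAt (𝓡∂ (2 * n)) p).symm x)) y)
      (extChartAt (𝓡∂ (2 * n)) p p)

/-- The Riemannian volume measure of the domain of the preferred chart around `p`, that is the
measure `|g|^{1/2} dx` in these coordinates. -/
def chartVolume [MeasurableSpace M] (g : Metric n M) (p : M) : Measure M :=
  (((volume : Measure (EuclideanSpace ℝ (Fin (2 * n)))).restrict
      (extChartAt (𝓡∂ (2 * n)) p).target).withDensity
        (fun y ↦ ENNReal.ofReal √(metricCoord g p y).det)).map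
    (extChartAt (𝓡∂ (2 * n)) p).symm

/-- The Riemannian volume measure `dV_g`: the least measure that dominates the volume measures of
all chart domains. These agree on the overlaps of the chart domains, so the restriction of `dV_g`
to each chart domain is the volume measure of that domain. -/
def riemannianVolume [MeasurableSpace M] (g : Metric n M) : Measure M :=
  ⨆ p : M, chartVolume g p

end metric

/-- All derivatives of `f` (of every order `k ≥ 0`) vanish at every boundary point. -/
def VanishesToInfiniteOrderAtBoundary (n : ℕ) [NeZero n] {M : Type*} [TopologicalSpace M]
    [ChartedSpace (EuclideanHalfSpace (2 * n)) M] (f : M → ℂ) : Prop :=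
  ∀ p ∈ (𝓡∂ (2 * n)).boundary M, ∀ k : ℕ,
    iteratedFDerivWithin ℝ k (fun y ↦ f ((extChartAt (𝓡∂ (2 * n)) p).symm y))
      (range (𝓡∂ (2 * n))) (extChartAt (𝓡∂ (2 * n)) p p) = 0

end KahlerCalderon

end

/-
For a Kähler metric, a holomorphic function `u` is harmonic up to the boundary: `du ∘ J = i du` and
`∇J = 0` give `H J = i H` for the covariant Hessian `H` of `u`, and as `H` is symmetric and `g` is
`J`-invariant, `tr (g⁻¹ H) = tr (J g⁻¹ Jᵀ H) = i² tr (g⁻¹ H)`, so the trace, which is `-Δ_g u`,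
vanishes. Hence `u` and the conjugate of any `v ∈ 𝒪(M)` are harmonic, and the integral of `f`
against each product `u * conj v` is zero. By the Stone–Weierstrass theorem these products span a
dense subspace of `C(M, ℂ)`, so `∫ |f|² dV_g = 0`. Since `dV_g` is positive on nonempty open sets,
`f = 0`.
-/

noncomputable section

namespace KahlerCalderon

section MatrixAlgebra

open Matrix

variable {ι R : Type*} [Fintype ι] [DecidableEq ι]

section CommRing

variable [CommRing R]

lemma mul_inv_mul_transpose_eq_inv {G J : Matrix ι ι R} (hG : IsUnit G.det)
    (hJ : Jᵀ * G * J = G) : J * G⁻¹ * Jᵀ = G⁻¹ := by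
  have hleft : G⁻¹ * Jᵀ * G * J = 1 := by
    rw [mul_assoc, mul_assoc, ← mul_assoc Jᵀ, hJ, nonsing_inv_mul _ hG]
  refine (inv_eq_left_inv ?_).symm
  simpa only [mul_assoc] using mul_eq_one_comm.1 hleft

omit [DecidableEq ι] in
lemma trace_mul_eq_zero_of_mul_eq_smul [NoZeroDivisors R] [CharZero R]
    {A H J : Matrix ι ι R} {c : R} (hc : c * c = -1)
    (hA : J * A * Jᵀ = A) (hH : H.IsSymm) (hHJ : H * J = c • H) : (A * H).trace = 0 := by
  have hJH : Jᵀ * H = c • H := by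
    have h := congrArg transpose hHJ
    rwa [transpose_mul, transpose_smul, hH] at h
  refine self_eq_neg.1 ?_
  calc (A * H).trace = (J * A * Jᵀ * H).trace := by rw [hA]
    _ = (A * (Jᵀ * H * J)).trace := by
      rw [mul_assoc, mul_assoc, trace_mul_comm, mul_assoc A]
    _ = -(A * H).trace := by
      rw [hJH, smul_mul_assoc, hHJ, smul_smul, hc, neg_one_smul, mul_neg, trace_neg]

omit [DecidableEq ι] in
lemma covariantDeriv_vecMul {C dC Γ : Matrix ι ι R} {w dw : ι → R} {c : R}
    (hC : dC + Γ * C - C * Γ = 0) (hw : w ᵥ* C = c • w)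
    (hdw : dw ᵥ* C + w ᵥ* dC = c • dw) :
    (dw - w ᵥ* Γ) ᵥ* C = c • (dw - w ᵥ* Γ) := by
  have hdC : dC = C * Γ - Γ * C := eq_sub_of_add_eq (sub_eq_zero.1 hC)
  calc (dw - w ᵥ* Γ) ᵥ* C = c • dw - w ᵥ* (dC + Γ * C) := by
        rw [← hdw, sub_vecMul, vecMul_vecMul, vecMul_add]; abel
    _ = c • (dw - w ᵥ* Γ) := by
        rw [hdC, sub_add_cancel, ← vecMul_vecMul, hw, smul_vecMul, smul_sub]

omit [DecidableEq ι] in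
lemma sum_trace_mul_mul_apply {A : Matrix ι ι R} (hA : A.IsSymm) (B : ι → Matrix ι ι R) (k : ι) :
    ∑ l, (A * B l).trace * A l k = ∑ i, ∑ j, ∑ l, A i j * A k l * B l i j := by
  calc ∑ l, (A * B l).trace * A l k = ∑ l, ∑ i, ∑ j, A i j * A k l * B l i j := by
        refine Finset.sum_congr rfl fun l _ ↦ ?_
        simp only [trace, diag_apply, mul_apply, Finset.sum_mul]
        rw [Finset.sum_comm]
        exact Finset.sum_congr rfl fun i _ ↦ Finset.sum_congr rfl fun j _ ↦ by
          rw [hA.apply i j, hA.apply k l]; ring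
    _ = ∑ i, ∑ l, ∑ j, A i j * A k l * B l i j := Finset.sum_comm
    _ = ∑ i, ∑ j, ∑ l, A i j * A k l * B l i j := Finset.sum_congr rfl fun i _ ↦ Finset.sum_comm

end CommRing

variable {K : Type*} [Field K]

/-- The covariant derivative `∇ᵢ wⱼ = ∂ᵢ wⱼ - ∑ₖ Γᵏᵢⱼ wₖ` of a one-form at a point, where `dw i` is
the derivative of `w` in the `i`-th coordinate direction and `Γ i` is the matrix `(Γᵏᵢⱼ)ₖⱼ`. -/
def covariantDeriv (Γ : ι → Matrix ι ι K) (w : ι → K) (dw : ι → ι → K) : Matrix ι ι K :=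
  of fun i ↦ dw i - w ᵥ* Γ i

/-- The matrix `(Γᵏᵢⱼ)ₖⱼ` of Christoffel symbols in the `i`-th coordinate direction, where `A` is
the inverse of the metric and `dG l` is its derivative in the `l`-th coordinate direction. -/
def christoffelMatrix (A : Matrix ι ι K) (dG : ι → Matrix ι ι K) (i : ι) : Matrix ι ι K :=
  of fun k j ↦ (1 / 2) * ∑ l, A k l * (dG i j l + dG j i l - dG l i j)

omit [DecidableEq ι] in
lemma trace_mul_covariantDeriv {A : Matrix ι ι K} (hA : A.IsSymm) (Γ : ι → Matrix ι ι K)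
    (w : ι → K) (dw : ι → ι → K) :
    (A * covariantDeriv Γ w dw).trace = ∑ i, A i ⬝ᵥ dw i - (∑ i, Γ i *ᵥ A i) ⬝ᵥ w := by
  calc (A * covariantDeriv Γ w dw).trace = ∑ i, A i ⬝ᵥ (dw i - w ᵥ* Γ i) := by
        rw [trace_mul_comm]
        exact Finset.sum_congr rfl fun i _ ↦ by
          rw [diag_apply, mul_apply', dotProduct_comm]
          exact congrArg (· ⬝ᵥ _) (funext fun j ↦ hA.apply i j)
    _ = _ := by
        simp only [dotProduct_sub, Finset.sum_sub_distrib, sum_dotProduct,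
          dotProduct_comm (Γ _ *ᵥ A _), dotProduct_mulVec, dotProduct_comm _ (A _)]

omit [DecidableEq ι] in
lemma map_christoffelMatrix {L : Type*} [Field L] (f : K →+* L) (A : Matrix ι ι K)
    (dG : ι → Matrix ι ι K) (i : ι) :
    (christoffelMatrix A dG i).map f = christoffelMatrix (A.map f) (fun l ↦ (dG l).map f) i := by
  ext k j
  simp [christoffelMatrix, map_ofNat f 2]

omit [DecidableEq ι] in
lemma sum_christoffelMatrix_mulVec [CharZero K] {A : Matrix ι ι K} (hA : A.IsSymm)
    (dG : ι → Matrix ι ι K) :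
    ∑ i, christoffelMatrix A dG i *ᵥ A i =
      ∑ i, (A * dG i * A - ((1 / 2) * (A * dG i).trace) • A) i := by
  ext k
  have hfirst : ∑ i, (A * dG i * A) i k = ∑ i, ∑ j, ∑ l, A i j * A k l * dG i j l := by
    simp only [mul_apply, Finset.sum_mul]
    refine Finset.sum_congr rfl fun i _ ↦ ?_
    rw [Finset.sum_comm]
    exact Finset.sum_congr rfl fun j _ ↦ Finset.sum_congr rfl fun l _ ↦ by
      rw [hA.apply l k]; ring
  have hsecond : ∑ i, ∑ j, ∑ l, A i j * A k l * dG j i l =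
      ∑ i, ∑ j, ∑ l, A i j * A k l * dG i j l := by
    rw [Finset.sum_comm]
    simp only [hA.apply]
  calc (∑ i, christoffelMatrix A dG i *ᵥ A i) k
      = ∑ i, ∑ j, ∑ l, (1 / 2) * (A i j * A k l * dG i j l + A i j * A k l * dG j i l -
          A i j * A k l * dG l i j) := by
        simp only [christoffelMatrix, mulVec, dotProduct, of_apply, Finset.sum_apply,
          Finset.mul_sum, Finset.sum_mul]
        exact Finset.sum_congr rfl fun i _ ↦ Finset.sum_congr rfl fun j _ ↦
          Finset.sum_congr rfl fun l _ ↦ by ring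
    _ = ∑ i, (A * dG i * A) i k - (1 / 2) * ∑ i, (A * dG i).trace * A i k := by
        simp only [← Finset.mul_sum, Finset.sum_sub_distrib, Finset.sum_add_distrib, hsecond,
          hfirst, sum_trace_mul_mul_apply hA]
        ring
    _ = _ := by
        simp only [Finset.sum_apply, Matrix.sub_apply, Matrix.smul_apply,
          Finset.sum_sub_distrib, smul_eq_mul, mul_assoc, Finset.mul_sum]

end MatrixAlgebra

section MatrixCalculus

open scoped Matrix.Norms.Operator
open Matrix

variable {ι : Type*} [Fintype ι] [DecidableEq ι]
variable {E : Type*} [NormedAddCommGroup E] [NormedSpace ℝ E] {s : Set E} {x : E}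
  {G : E → Matrix ι ι ℝ} {G' : E →L[ℝ] Matrix ι ι ℝ}

lemma hasDerivAt_det_add_smul {A : Matrix ι ι ℝ} (hA : IsUnit A.det) (B : Matrix ι ι ℝ) :
    HasDerivAt (fun t : ℝ ↦ (A + t • B).det) (A.det * (A⁻¹ * B).trace) 0 := by
  let P : Polynomial ℝ := (1 + (Polynomial.X : Polynomial ℝ) • (A⁻¹ * B).map Polynomial.C).det
  have hP (t : ℝ) : (A + t • B).det = A.det * P.eval t := by
    have hfactor : A + t • B = A * (1 + t • (A⁻¹ * B)) := by
      rw [mul_add, mul_one, Matrix.mul_smul, ← mul_assoc, mul_nonsing_inv _ hA, one_mul]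
    rw [hfactor, det_mul, ← Polynomial.coe_evalRingHom, RingHom.map_det]
    congr 2
    ext i j
    simp [one_apply, apply_ite (Polynomial.eval t), mul_comm t, -Matrix.map_mul]
  rw [funext hP, ← derivative_det_one_add_X_smul]
  exact (P.hasDerivAt 0).const_mul _

lemma differentiable_det : Differentiable ℝ (det : Matrix ι ι ℝ → ℝ) := by
  have (i j : ι) : Differentiable ℝ fun A : Matrix ι ι ℝ ↦ A i j :=
    (entryLinearMap ℝ ℝ i j).toContinuousLinearMap.differentiable
  simp only [funext det_apply']
  fun_prop

lemma fderiv_det_apply {A : Matrix ι ι ℝ} (hA : IsUnit A.det) (B : Matrix ι ι ℝ) :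
    fderiv ℝ det A B = A.det * (A⁻¹ * B).trace :=
  ((differentiable_det A).hasFDerivAt.hasLineDerivAt B).unique (hasDerivAt_det_add_smul hA B)

lemma hasFDerivAt_matrix_inv {A : Matrix ι ι ℝ} (hA : IsUnit A.det) :
    HasFDerivAt (fun B : Matrix ι ι ℝ ↦ B⁻¹)
      (-(ContinuousLinearMap.mulLeftRight ℝ (Matrix ι ι ℝ) A⁻¹ A⁻¹)) A := by
  obtain ⟨U, rfl⟩ := (isUnit_iff_isUnit_det A).2 hA
  simpa only [nonsing_inv_eq_ringInverse, Ring.inverse_unit] using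
    hasFDerivAt_ringInverse (𝕜 := ℝ) U

lemma differentiableWithinAt_sqrt_det_smul_inv (hG : DifferentiableWithinAt ℝ G s x)
    (hpos : 0 < (G x).det) : DifferentiableWithinAt ℝ (fun y ↦ √(G y).det • (G y)⁻¹) s x :=
  (((differentiable_det (G x)).comp_differentiableWithinAt x hG).sqrt hpos.ne').smul
    ((hasFDerivAt_matrix_inv hpos.ne'.isUnit).differentiableAt.comp_differentiableWithinAt x hG)

lemma fderivWithin_sqrt_det_smul_inv (hG : DifferentiableWithinAt ℝ G s x)
    (hs : UniqueDiffWithinAt ℝ s x) (hpos : 0 < (G x).det) (v : E) :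
    fderivWithin ℝ (fun y ↦ √(G y).det • (G y)⁻¹) s x v = √(G x).det •
      (((1 / 2) * ((G x)⁻¹ * fderivWithin ℝ G s x v).trace) • (G x)⁻¹ -
        (G x)⁻¹ * fderivWithin ℝ G s x v * (G x)⁻¹) := by
  have hcoeff : 1 / (2 * √(G x).det) * (G x).det = √(G x).det * (1 / 2) := by
    have := (Real.sqrt_pos.2 hpos).ne'
    field_simp
    rw [Real.sq_sqrt hpos.le]
  have hsqrt := ((differentiable_det (G x)).hasFDerivAt.comp_hasFDerivWithinAt x
    hG.hasFDerivWithinAt).sqrt hpos.ne'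
  have hinv := (hasFDerivAt_matrix_inv hpos.ne'.isUnit).comp_hasFDerivWithinAt x
    hG.hasFDerivWithinAt
  calc fderivWithin ℝ (fun y ↦ √(G y).det • (G y)⁻¹) s x v
      = √(G x).det • -((G x)⁻¹ * fderivWithin ℝ G s x v * (G x)⁻¹) +
          (1 / (2 * √(G x).det) * fderiv ℝ det (G x) (fderivWithin ℝ G s x v)) • (G x)⁻¹ :=
        congrArg (· v) ((hsqrt.smul hinv).fderivWithin hs)
    _ = _ := by
        rw [fderiv_det_apply hpos.ne'.isUnit, ← mul_assoc, hcoeff, smul_sub, smul_smul, smul_neg,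
          mul_assoc √(G x).det]
        abel

omit [Fintype ι] [DecidableEq ι] in
lemma fderivWithin_matrix_apply [Finite ι] (hG : DifferentiableWithinAt ℝ G s x)
    (hs : UniqueDiffWithinAt ℝ s x) (i j : ι) (v : E) :
    fderivWithin ℝ (fun y ↦ G y i j) s x v = fderivWithin ℝ G s x v i j := by
  have := Fintype.ofFinite ι
  have h := hasFDerivWithinAt_pi'.1 (hasFDerivWithinAt_pi'.1 hG.hasFDerivWithinAt i) j
  exact congrArg (· v) (h.fderivWithin hs)

omit [Fintype ι] [DecidableEq ι] in
lemma fderivWithin_ofReal_mul_apply [Finite ι] {A : E → Matrix ι ι ℝ}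
    (hA : DifferentiableWithinAt ℝ A s x) {w : E → ι → ℂ} (hw : DifferentiableWithinAt ℝ w s x)
    (hs : UniqueDiffWithinAt ℝ s x) (i j : ι) (v : E) :
    fderivWithin ℝ (fun y ↦ (A y i j : ℂ) * w y j) s x v =
      (A x i j : ℂ) * fderivWithin ℝ w s x v j + (fderivWithin ℝ A s x v i j : ℂ) * w x j := by
  have := Fintype.ofFinite ι
  have hAij := hasFDerivWithinAt_pi'.1 (hasFDerivWithinAt_pi'.1 hA.hasFDerivWithinAt i) j
  have hwj := hasFDerivWithinAt_pi'.1 hw.hasFDerivWithinAt j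
  have hprod :=
    ((Complex.ofRealCLM.hasFDerivAt.comp_hasFDerivWithinAt x hAij).mul hwj).fderivWithin hs
  rw [mul_comm ((fderivWithin ℝ A s x v i j : ℝ) : ℂ)]
  exact congrArg (· v) hprod

lemma sum_fderivWithin_sqrt_det_mul_inv (hG : DifferentiableWithinAt ℝ G s x)
    (hsymm : (G x).IsSymm) (hs : UniqueDiffWithinAt ℝ s x) (hpos : 0 < (G x).det) (e : ι → E)
    {w : E → ι → ℂ} (hw : DifferentiableWithinAt ℝ w s x) :
    ∑ i, ∑ j, fderivWithin ℝ (fun y ↦ ((√(G y).det * (G y)⁻¹ i j : ℝ) : ℂ) * w y j) s x (e i) =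
      (√(G x).det : ℂ) * ((G x)⁻¹.map Complex.ofRealHom *
        covariantDeriv (fun i ↦ (christoffelMatrix (G x)⁻¹
            (fun l ↦ fderivWithin ℝ G s x (e l)) i).map Complex.ofRealHom) (w x)
          fun i ↦ fderivWithin ℝ w s x (e i)).trace := by
  have hinv : (G x)⁻¹.IsSymm := by rw [IsSymm, transpose_nonsing_inv, hsymm]
  let T (i : ι) : Matrix ι ι ℝ := (G x)⁻¹ * fderivWithin ℝ G s x (e i) * (G x)⁻¹ -
    ((1 / 2) * ((G x)⁻¹ * fderivWithin ℝ G s x (e i)).trace) • (G x)⁻¹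
  have hterm (i j : ι) :
      fderivWithin ℝ (fun y ↦ ((√(G y).det * (G y)⁻¹ i j : ℝ) : ℂ) * w y j) s x (e i) =
        (√(G x).det : ℂ) *
          (((G x)⁻¹ i j : ℂ) * fderivWithin ℝ w s x (e i) j - T i i j * w x j) := by
    refine (fderivWithin_ofReal_mul_apply
      (differentiableWithinAt_sqrt_det_smul_inv hG hpos) hw hs i j (e i)).trans ?_
    rw [fderivWithin_sqrt_det_smul_inv hG hs hpos, ← neg_sub]
    change ((√(G x).det * (G x)⁻¹ i j : ℝ) : ℂ) * _ + ((√(G x).det * -T i i j : ℝ) : ℂ) * _ = _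
    push_cast
    ring
  have hT : ∑ i, christoffelMatrix ((G x)⁻¹.map Complex.ofRealHom)
      (fun l ↦ (fderivWithin ℝ G s x (e l)).map Complex.ofRealHom) i *ᵥ
        (G x)⁻¹.map Complex.ofRealHom i = ∑ i, (T i).map Complex.ofRealHom i := by
    rw [sum_christoffelMatrix_mulVec (hinv.map _)]
    refine Finset.sum_congr rfl fun i _ ↦ funext fun k ↦ ?_
    simp only [← Matrix.map_mul, ← AddMonoidHom.map_trace]
    simp [T, -Matrix.map_mul]
  simp only [map_christoffelMatrix, trace_mul_covariantDeriv (hinv.map _), hT, hterm,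
    ← Finset.mul_sum, Finset.sum_sub_distrib, sum_dotProduct]
  rfl

omit [DecidableEq ι] in
lemma fderivWithin_vecMul_map_ofReal (hG : DifferentiableWithinAt ℝ G s x) {w : E → ι → ℂ}
    (hw : DifferentiableWithinAt ℝ w s x) (hs : UniqueDiffWithinAt ℝ s x) (v : E) :
    fderivWithin ℝ (fun y ↦ w y ᵥ* (G y).map Complex.ofRealHom) s x v =
      fderivWithin ℝ w s x v ᵥ* (G x).map Complex.ofRealHom +
        w x ᵥ* (fderivWithin ℝ G s x v).map Complex.ofRealHom := by
  let B := (vecMulBilin (m := ι) (n := ι) (A := ℂ) ℝ ℝ).toContinuousBilinearMap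
  let L := (Complex.ofRealCLM.toLinearMap.mapMatrix (m := ι) (n := ι)).toContinuousLinearMap
  have h := B.hasFDerivWithinAt_of_bilinear hw.hasFDerivWithinAt
    (L.hasFDerivAt.comp_hasFDerivWithinAt x hG.hasFDerivWithinAt)
  refine (congrArg (· v) (h.fderivWithin hs)).trans ?_
  exact add_comm _ _

end MatrixCalculus

section Charts

variable {𝕜 E H M F : Type*} [NontriviallyNormedField 𝕜]
  [NormedAddCommGroup E] [NormedSpace 𝕜 E] [TopologicalSpace H] {I : ModelWithCorners 𝕜 E H}
  [TopologicalSpace M] [ChartedSpace H M] [NormedAddCommGroup F] [NormedSpace 𝕜 F]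
  {m : ℕ∞ω} {p : M} {y : E}

lemma extChartAt_symm_mem_chart_source (hy : y ∈ (extChartAt I p).target) :
    (extChartAt I p).symm y ∈ (chartAt H p).source :=
  extChartAt_source I p ▸ (extChartAt I p).map_target hy

lemma extChartAt_target_subset_closure_inter_interior (p : M) :
    (extChartAt I p).target ⊆ closure ((extChartAt I p).target ∩ interior (range I)) := by
  intro y hy
  obtain ⟨U, hU, hUy, hUI⟩ := mem_nhdsWithin.1 (extChartAt_target_mem_nhdsWithin_of_mem hy)
  have hUint : U ∩ interior (range I) ⊆ (extChartAt I p).target ∩ interior (range I) :=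
    fun z hz ↦ ⟨hUI ⟨hz.1, interior_subset hz.2⟩, hz.2⟩
  refine closure_mono hUint (hU.inter_closure ⟨hUy, ?_⟩)
  exact I.range_subset_closure_interior (extChartAt_target_subset_range p hy)

lemma contDiffWithinAt_range_of_contDiffOn_target {f : E → F}
    (hf : ContDiffOn 𝕜 m f (extChartAt I p).target) (hy : y ∈ (extChartAt I p).target) :
    ContDiffWithinAt 𝕜 m f (range I) y :=
  (hf y hy).mono_of_mem_nhdsWithin (extChartAt_target_mem_nhdsWithin_of_mem hy)

lemma contDiffOn_comp_extChartAt_symm [IsManifold I m M] {u : M → F}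
    (hu : ContMDiffOn I 𝓘(𝕜, F) m u (chartAt H p).source) :
    ContDiffOn 𝕜 m (u ∘ (extChartAt I p).symm) (extChartAt I p).target :=
  contMDiffOn_iff_contDiffOn.1 (hu.comp (contMDiffOn_extChartAt_symm p)
    fun _ ↦ extChartAt_symm_mem_chart_source)

end Charts

section RealCharts

variable {E H M : Type*} [NormedAddCommGroup E] [NormedSpace ℝ E]
  [TopologicalSpace H] {I : ModelWithCorners ℝ E H} [TopologicalSpace M] [ChartedSpace H M]

lemma extChartAt_symm_mem_interior [IsManifold I 1 M] {p : M} {y : E}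
    (hy : y ∈ (extChartAt I p).target) (hyI : y ∈ interior (range I)) :
    (extChartAt I p).symm y ∈ I.interior M := by
  have hsource := extChartAt_symm_mem_chart_source hy
  refine (I.isInteriorPoint_iff_of_mem_atlas one_ne_zero (chart_mem_atlas H p) hsource).2 ?_
  refine OpenPartialHomeomorph.mem_interior_extend_target _ ((chartAt H p).map_source hsource) ?_
  rwa [← (extChartAt I p).right_inv hy] at hyI

end RealCharts

lemma fderivWithin_fderivWithin_apply_comm {E F : Type*} [NormedAddCommGroup E] [NormedSpace ℝ E]
    [NormedAddCommGroup F] [NormedSpace ℝ F] {u : E → F} {s : Set E} {x : E}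
    (hu : ContDiffWithinAt ℝ 2 u s x) (hs : UniqueDiffOn ℝ s) (hx : x ∈ s)
    (hxs : x ∈ closure (interior s)) (v w : E) :
    fderivWithin ℝ (fun y ↦ fderivWithin ℝ u s y v) s x w =
      fderivWithin ℝ (fun y ↦ fderivWithin ℝ u s y w) s x v := by
  have hdiff : DifferentiableWithinAt ℝ (fderivWithin ℝ u s) s x :=
    (hu.fderivWithin_right (m := 1) hs (by norm_num) hx).differentiableWithinAt one_ne_zero
  have hsecond (a b : E) : fderivWithin ℝ (fun y ↦ fderivWithin ℝ u s y a) s x b =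
      fderivWithin ℝ (fderivWithin ℝ u s) s x b a := by
    rw [fderivWithin_clm_apply (hs x hx) hdiff (differentiableWithinAt_const a)]
    simp
  rw [hsecond, hsecond]
  exact hu.isSymmSndFDerivWithinAt (by simp) hs hxs hx w v

section Coordinates

variable {n : ℕ} [NeZero n] {M : Type*} [TopologicalSpace M]
  [ChartedSpace (EuclideanHalfSpace (2 * n)) M]

local notation "ℝ²ⁿ" => EuclideanSpace ℝ (Fin (2 * n))
local notation "φ" => extChartAt (𝓡∂ (2 * n))

/-- The components `∂ⱼu` of the differential of `u` in the preferred chart around `p`. -/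
def coordGrad (u : M → ℂ) (p : M) (y : ℝ²ⁿ) : Fin (2 * n) → ℂ :=
  fun j ↦ partialDeriv n j (u ∘ (φ p).symm) y

variable [IsManifold (𝓡∂ (2 * n)) ∞ M] {p : M}
  {y : EuclideanSpace ℝ (Fin (2 * n))}

lemma contDiffWithinAt_comp_symm {u : M → ℂ} (hu : Smooth n u) (hy : y ∈ (φ p).target) :
    ContDiffWithinAt ℝ ∞ (u ∘ (φ p).symm) (range (𝓡∂ (2 * n))) y :=
  contDiffWithinAt_range_of_contDiffOn_target (contDiffOn_comp_extChartAt_symm hu.contMDiffOn) hy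

lemma contDiffWithinAt_coordGrad {u : M → ℂ} (hu : Smooth n u) (hy : y ∈ (φ p).target) :
    ContDiffWithinAt ℝ ∞ (coordGrad u p) (range (𝓡∂ (2 * n))) y :=
  contDiffWithinAt_pi.2 fun _ ↦ ((contDiffWithinAt_comp_symm hu hy).fderivWithin_right
    (𝓡∂ (2 * n)).uniqueDiffOn (by simp) (extChartAt_target_subset_range p hy)).clm_apply
      contDiffWithinAt_const

lemma differentiableWithinAt_coordGrad {u : M → ℂ} (hu : Smooth n u) (hy : y ∈ (φ p).target) :
    DifferentiableWithinAt ℝ (coordGrad u p) (range (𝓡∂ (2 * n))) y :=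
  (contDiffWithinAt_coordGrad hu hy).differentiableWithinAt (by simp)

lemma partialDeriv_apply {ι : Type*} [Fintype ι] {w : ℝ²ⁿ → ι → ℂ}
    (hw : DifferentiableWithinAt ℝ w (range (𝓡∂ (2 * n))) y)
    (hy : y ∈ range (𝓡∂ (2 * n))) (i : Fin (2 * n)) (j : ι) :
    partialDeriv n i w y j = partialDeriv n i (fun x ↦ w x j) y := by
  have h := (hasFDerivWithinAt_pi'.1 hw.hasFDerivWithinAt j).fderivWithin
    ((𝓡∂ (2 * n)).uniqueDiffOn y hy)
  exact (congrArg (· (stdVec n i)) h).symm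

lemma partialDeriv_coordGrad_comm {u : M → ℂ} (hu : Smooth n u) (hy : y ∈ (φ p).target)
    (i j : Fin (2 * n)) :
    partialDeriv n i (coordGrad u p) y j = partialDeriv n j (coordGrad u p) y i := by
  have hyI := extChartAt_target_subset_range p hy
  rw [partialDeriv_apply (differentiableWithinAt_coordGrad hu hy) hyI,
    partialDeriv_apply (differentiableWithinAt_coordGrad hu hy) hyI]
  exact fderivWithin_fderivWithin_apply_comm ((contDiffWithinAt_comp_symm hu hy).of_le
    ENat.LEInfty.out) (𝓡∂ (2 * n)).uniqueDiffOn hyI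
    ((𝓡∂ (2 * n)).range_subset_closure_interior hyI) _ _

lemma differential_coordVec {u : M → ℂ} (hu : Smooth n u) (hy : y ∈ (φ p).target)
    (i : Fin (2 * n)) :
    differential u ((φ p).symm y) (coordVec p y i) = coordGrad u p y i := by
  have hdiff : MDifferentiable (𝓡∂ (2 * n)) 𝓘(ℝ, ℂ) u := hu.mdifferentiable (by simp)
  have h := mfderiv_comp_mfderivWithin (I := 𝓘(ℝ, ℝ²ⁿ)) y (hdiff _)
    (mdifferentiableWithinAt_extChartAt_symm hy)
    ((𝓡∂ (2 * n)).uniqueMDiffOn _ (extChartAt_target_subset_range p hy))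
  rw [mfderivWithin_eq_fderivWithin] at h
  exact (congrArg (fun L : ℝ²ⁿ →L[ℝ] ℂ ↦ L (stdVec n i)) h).symm

lemma differential_extChartAt_coordVec (hy : y ∈ (φ p).target) (i : Fin (2 * n)) :
    differential (φ p) ((φ p).symm y) (coordVec p y i) = stdVec n i :=
  congrArg (fun L : ℝ²ⁿ →L[ℝ] ℝ²ⁿ ↦ L (stdVec n i))
    (mfderiv_extChartAt_comp_mfderivWithin_extChartAt_symm (I := 𝓡∂ (2 * n)) hy)

omit [NeZero n] in
lemma sum_smul_stdVec (v : ℝ²ⁿ) : ∑ k, v k • stdVec n k = v := by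
  simpa using (EuclideanSpace.basisFun (Fin (2 * n)) ℝ).sum_repr v

lemma sum_differential_extChartAt_smul_coordVec (hy : y ∈ (φ p).target)
    (v : TangentSpace (𝓡∂ (2 * n)) ((φ p).symm y)) :
    ∑ k, differential (F := ℝ²ⁿ) (φ p) ((φ p).symm y) v k • coordVec p y k = v := by
  have h := congrArg (· v)
    (mfderivWithin_extChartAt_symm_comp_mfderiv_extChartAt (I := 𝓡∂ (2 * n)) hy)
  set w : ℝ²ⁿ := differential (F := ℝ²ⁿ) (φ p) ((φ p).symm y) v
  calc ∑ k, w k • coordVec p y k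
      = mfderivWithin 𝓘(ℝ, ℝ²ⁿ) (𝓡∂ (2 * n)) (φ p).symm (range (𝓡∂ (2 * n))) y
          (∑ k, w k • stdVec n k) :=
        ((map_sum _ _ _).trans (Finset.sum_congr rfl fun _ _ ↦ map_smul _ _ _)).symm
    _ = v := (congrArg _ (sum_smul_stdVec w)).trans h

/-- The coordinate vector fields of the preferred chart around `p`, as sections of the tangent
bundle over `M`. -/
abbrev coordFrame (p : M) (i : Fin (2 * n)) (x : M) : TangentSpace (𝓡∂ (2 * n)) x :=
  (trivializationAt ℝ²ⁿ (TangentSpace (𝓡∂ (2 * n))) p).localFrame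
    (EuclideanSpace.basisFun (Fin (2 * n)) ℝ).toBasis i x

lemma coordVec_eq_coordFrame (hy : y ∈ (φ p).target) (i : Fin (2 * n)) :
    coordVec p y i = coordFrame p i ((φ p).symm y) := by
  have hx := extChartAt_symm_mem_chart_source hy
  have hbase : (φ p).symm y ∈
      (trivializationAt ℝ²ⁿ (TangentSpace (𝓡∂ (2 * n))) p).baseSet := by simpa using hx
  have hsymm := congrArg (fun L : ℝ²ⁿ →L[ℝ] ℝ²ⁿ ↦ L (stdVec n i))
    (TangentBundle.symmL_trivializationAt (𝕜 := ℝ) (I := 𝓡∂ (2 * n)) hx)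
  rw [(φ p).right_inv hy] at hsymm
  rw [coordFrame, Bundle.Trivialization.localFrame_apply_of_mem_baseSet _ _ hbase,
    Bundle.Trivialization.basisAt, Module.Basis.map_apply, OrthonormalBasis.coe_toBasis,
    EuclideanSpace.basisFun_apply]
  exact hsymm.symm.trans (Bundle.Trivialization.symmL_apply _ hbase _)

lemma contMDiffOn_coordFrame (p : M) (i : Fin (2 * n)) :
    ContMDiffOn (𝓡∂ (2 * n)) ((𝓡∂ (2 * n)).prod 𝓘(ℝ, ℝ²ⁿ)) ∞
      (fun x ↦ (⟨x, coordFrame p i x⟩ : TangentBundle (𝓡∂ (2 * n)) M))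
      (chartAt (EuclideanHalfSpace (2 * n)) p).source :=
  (trivializationAt ℝ²ⁿ (TangentSpace (𝓡∂ (2 * n))) p).contMDiffOn_localFrame_baseSet ∞
    (EuclideanSpace.basisFun (Fin (2 * n)) ℝ).toBasis i

lemma contDiffOn_metricCoord (g : Metric n M) (p : M) (i j : Fin (2 * n)) :
    ContDiffOn ℝ ∞ (fun y ↦ metricCoord g p y i j) (φ p).target := by
  have hinner : ContMDiffOn (𝓡∂ (2 * n)) 𝓘(ℝ, ℝ) ∞
      (fun x : M ↦ g.inner x (coordFrame p i x) (coordFrame p j x))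
      (chartAt (EuclideanHalfSpace (2 * n)) p).source := by
    have htotal := g.contMDiff.contMDiffOn.clm_bundle_apply₂ (F₁ := ℝ²ⁿ) (F₂ := ℝ²ⁿ)
      (contMDiffOn_coordFrame p i) (contMDiffOn_coordFrame p j)
    exact fun x hx ↦ (Bundle.contMDiffWithinAt_totalSpace.1 (htotal x hx)).2
  refine (contDiffOn_comp_extChartAt_symm hinner).congr fun y hy ↦ ?_
  simp only [metricCoord, Matrix.of_apply, Function.comp_apply, coordVec_eq_coordFrame hy]

lemma contDiffOn_complexCoord (S : ComplexStructure n M) (p : M) (k j : Fin (2 * n)) :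
    ContDiffOn ℝ ∞ (complexCoord S p k j) (φ p).target := by
  set e := trivializationAt ℝ²ⁿ (TangentSpace (𝓡∂ (2 * n))) p
  have hcoord : ContMDiffOn (𝓡∂ (2 * n)) 𝓘(ℝ, ℝ²ⁿ) ∞
      (fun x ↦ (e ⟨x, S.J x (coordFrame p j x)⟩).2) e.baseSet :=
    e.contMDiffOn_section_baseSet_iff.1
      (S.smooth.contMDiffOn.clm_bundle_apply (contMDiffOn_coordFrame p j))
  refine ((EuclideanSpace.proj (𝕜 := ℝ) k).contDiff.comp_contDiffOn
    (contDiffOn_comp_extChartAt_symm hcoord)).congr fun y hy ↦ ?_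
  have hx := extChartAt_symm_mem_chart_source hy
  have hbase : (φ p).symm y ∈ e.baseSet := hx
  simp only [complexCoord, differential, coordVec_eq_coordFrame hy]
  rw [← TangentBundle.continuousLinearMapAt_trivializationAt hx,
    Bundle.Trivialization.continuousLinearMapAt_apply_of_mem _ _ hbase]
  rfl

lemma J_coordVec (S : ComplexStructure n M) (hy : y ∈ (φ p).target) (j : Fin (2 * n)) :
    S.J _ (coordVec p y j) = ∑ k, complexCoord S p k j y • coordVec p y k :=
  (sum_differential_extChartAt_smul_coordVec hy _).symm

lemma linearIndependent_coordVec (hy : y ∈ (φ p).target) :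
    LinearIndependent ℝ (coordVec p y) := by
  refine Fintype.linearIndependent_iff.2 fun v hv i ↦ ?_
  have hdiff := congrArg (differential (F := ℝ²ⁿ) (φ p) ((φ p).symm y)) hv
  simp only [map_sum, map_smul, map_zero, differential_extChartAt_coordVec hy] at hdiff
  exact congrArg (· i) ((sum_smul_stdVec (WithLp.toLp 2 v)).symm.trans hdiff)

section Matrices

open Matrix
open scoped Matrix.Norms.Operator

lemma inner_sum_smul_coordVec (g : Metric n M) (p : M) (y : ℝ²ⁿ) (v w : Fin (2 * n) → ℝ) :
    g.inner _ (∑ i, v i • coordVec p y i) (∑ j, w j • coordVec p y j) =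
      v ⬝ᵥ metricCoord g p y *ᵥ w := by
  simp only [map_sum, map_smul, _root_.sum_apply, _root_.smul_apply, smul_eq_mul, dotProduct,
    mulVec, metricCoord, of_apply, Finset.mul_sum]
  rw [Finset.sum_comm]
  exact Finset.sum_congr rfl fun i _ ↦ Finset.sum_congr rfl fun j _ ↦ by ring

lemma metricCoord_isSymm (g : Metric n M) (p : M) (y : ℝ²ⁿ) : (metricCoord g p y).IsSymm :=
  IsSymm.ext fun _ _ ↦ g.symm _ _ _

lemma metricCoord_posDef (g : Metric n M) (hy : y ∈ (φ p).target) :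
    (metricCoord g p y).PosDef := by
  refine .of_dotProduct_mulVec_pos (isHermitian_iff_isSymm.2 (metricCoord_isSymm g p y))
    fun v hv ↦ ?_
  rw [star_trivial, ← inner_sum_smul_coordVec]
  exact g.pos _ _ fun hzero ↦
    hv (funext (Fintype.linearIndependent_iff.1 (linearIndependent_coordVec hy) v hzero))

lemma differentiableWithinAt_metricCoord (g : Metric n M) (hy : y ∈ (φ p).target) :
    DifferentiableWithinAt ℝ (metricCoord g p) (range (𝓡∂ (2 * n))) y :=
  differentiableWithinAt_pi.2 fun i ↦ differentiableWithinAt_pi.2 fun j ↦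
    (contDiffWithinAt_range_of_contDiffOn_target
      (contDiffOn_metricCoord g p i j) hy).differentiableWithinAt (by simp)

/-- The matrix `(Jᵏⱼ)ₖⱼ` of the almost complex structure in the preferred chart around `p`. -/
def complexMatrix (S : ComplexStructure n M) (p : M) (y : ℝ²ⁿ) :
    Matrix (Fin (2 * n)) (Fin (2 * n)) ℝ :=
  of fun k j ↦ complexCoord S p k j y

lemma differentiableWithinAt_complexMatrix (S : ComplexStructure n M) (hy : y ∈ (φ p).target) :
    DifferentiableWithinAt ℝ (complexMatrix S p) (range (𝓡∂ (2 * n))) y :=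
  differentiableWithinAt_pi.2 fun k ↦ differentiableWithinAt_pi.2 fun j ↦
    (contDiffWithinAt_range_of_contDiffOn_target
      (contDiffOn_complexCoord S p k j) hy).differentiableWithinAt (by simp)

lemma IsKahler.transpose_complexMatrix_mul_metricCoord_mul {S : ComplexStructure n M}
    {g : Metric n M} (hg : IsKahler S g) (hy : y ∈ (φ p).target) :
    (complexMatrix S p y)ᵀ * metricCoord g p y * complexMatrix S p y = metricCoord g p y := by
  ext i j
  have h := hg.compatible _ (coordVec p y i) (coordVec p y j)
  rw [J_coordVec S hy, J_coordVec S hy, inner_sum_smul_coordVec] at h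
  rw [mul_assoc]
  exact h

lemma partialDeriv_matrix_apply {A : ℝ²ⁿ → Matrix (Fin (2 * n)) (Fin (2 * n)) ℝ}
    (hA : DifferentiableWithinAt ℝ A (range (𝓡∂ (2 * n))) y) (hy : y ∈ range (𝓡∂ (2 * n)))
    (i k j : Fin (2 * n)) :
    partialDeriv n i (fun x ↦ A x k j) y = partialDeriv n i A y k j :=
  fderivWithin_matrix_apply hA ((𝓡∂ (2 * n)).uniqueDiffOn y hy) k j _

/-- The matrix `(Γᵏᵢⱼ)ₖⱼ` of Christoffel symbols of `g` in the `i`-th direction of the preferred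
chart around `p`. -/
def christoffelCoord (g : Metric n M) (p : M) (y : ℝ²ⁿ) (i : Fin (2 * n)) :
    Matrix (Fin (2 * n)) (Fin (2 * n)) ℝ :=
  christoffelMatrix (metricCoord g p y)⁻¹ (fun l ↦ partialDeriv n l (metricCoord g p) y) i

lemma christoffelCoord_apply (g : Metric n M) (hy : y ∈ (φ p).target) (i k j : Fin (2 * n)) :
    christoffelCoord g p y i k j = christoffel g p k i j y := by
  simp only [christoffel, christoffelCoord, christoffelMatrix, of_apply, partialDeriv_matrix_apply
    (differentiableWithinAt_metricCoord g hy) (extChartAt_target_subset_range p hy)]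

lemma christoffel_symm (g : Metric n M) (p : M) (k i j : Fin (2 * n)) (y : ℝ²ⁿ) :
    christoffel g p k i j y = christoffel g p k j i y := by
  have h (x : ℝ²ⁿ) : metricCoord g p x i j = metricCoord g p x j i :=
    (metricCoord_isSymm g p x).apply j i
  simp only [christoffel, h, add_comm (partialDeriv n i _ y)]

lemma IsKahler.partialDeriv_complexMatrix {S : ComplexStructure n M} {g : Metric n M}
    (hg : IsKahler S g) (p : M) (i : Fin (2 * n)) :
    partialDeriv n i (complexMatrix S p) (φ p p) +
      christoffelCoord g p (φ p p) i * complexMatrix S p (φ p p) -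
        complexMatrix S p (φ p p) * christoffelCoord g p (φ p p) i = 0 := by
  have hy : φ p p ∈ (φ p).target := mem_extChartAt_target p
  ext k j
  rw [Matrix.zero_apply, ← hg.parallel p i k j, covDerivJ, Finset.sum_sub_distrib, ← add_sub_assoc,
    Matrix.sub_apply, Matrix.add_apply, mul_apply, mul_apply, ← partialDeriv_matrix_apply
      (differentiableWithinAt_complexMatrix S hy) (extChartAt_target_subset_range p hy)]
  simp only [christoffelCoord_apply g hy, complexMatrix, of_apply,
    mul_comm (christoffel g p _ i j _)]

lemma coordGrad_vecMul_complexMatrix (S : ComplexStructure n M) {u : M → ℂ} (hu : Smooth n u)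
    (hy : y ∈ (φ p).target) (j : Fin (2 * n)) :
    (coordGrad u p y ᵥ* (complexMatrix S p y).map Complex.ofRealHom) j =
      differential u ((φ p).symm y) (S.J _ (coordVec p y j)) := by
  rw [J_coordVec S hy, map_sum]
  change ∑ k, coordGrad u p y k * (complexCoord S p k j y : ℂ) = _
  refine Finset.sum_congr rfl fun k _ ↦ ?_
  rw [map_smul, differential_coordVec hu hy, Complex.real_smul, mul_comm]

lemma ComplexStructure.coordGrad_vecMul_complexMatrix_eq_I_smul {S : ComplexStructure n M}
    {u : M → ℂ} (hu : u ∈ S.holomorphicFunctions) (hy : y ∈ (φ p).target) :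
    coordGrad u p y ᵥ* (complexMatrix S p y).map Complex.ofRealHom =
      Complex.I • coordGrad u p y := by
  have hgrad : ContinuousOn (coordGrad u p) (φ p).target := fun z hz ↦
    (differentiableWithinAt_coordGrad hu.1 hz).continuousWithinAt.mono
      (extChartAt_target_subset_range p)
  have hinterior : EqOn (fun z ↦ coordGrad u p z ᵥ* (complexMatrix S p z).map Complex.ofRealHom)
      (Complex.I • coordGrad u p) ((φ p).target ∩ interior (range (𝓡∂ (2 * n)))) := by
    refine fun z hz ↦ funext fun j ↦ ?_
    refine (coordGrad_vecMul_complexMatrix S hu.1 hz.1 j).trans ?_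
    rw [hu.2 _ (extChartAt_symm_mem_interior hz.1 hz.2), differential_coordVec hu.1 hz.1]
    rfl
  have hleft : ContinuousOn
      (fun z ↦ coordGrad u p z ᵥ* (complexMatrix S p z).map Complex.ofRealHom) (φ p).target := by
    refine continuousOn_pi.2 fun j ↦ ?_
    change ContinuousOn (fun z ↦ ∑ k, coordGrad u p z k * (complexCoord S p k j z : ℂ)) _
    exact continuousOn_finsetSum _ fun k _ ↦ (continuousOn_pi.1 hgrad k).mul
      (Complex.continuous_ofReal.comp_continuousOn (contDiffOn_complexCoord S p k j).continuousOn)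
  exact hinterior.of_subset_closure hleft (hgrad.const_smul _) inter_subset_left
    (extChartAt_target_subset_closure_inter_interior p) hy

end Matrices

end Coordinates

section Harmonic

open Matrix
open scoped Matrix.Norms.Operator

variable {n : ℕ} [NeZero n] {M : Type*} [TopologicalSpace M]
  [ChartedSpace (EuclideanHalfSpace (2 * n)) M] [IsManifold (𝓡∂ (2 * n)) ∞ M]

local notation "ℝ²ⁿ" => EuclideanSpace ℝ (Fin (2 * n))
local notation "φ" => extChartAt (𝓡∂ (2 * n))

/-- The covariant Hessian `∂ᵢ∂ⱼu - ∑ₖ Γᵏᵢⱼ ∂ₖu` in the preferred chart around `p`. -/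
def hessian (g : Metric n M) (u : M → ℂ) (p : M) (y : ℝ²ⁿ) :
    Matrix (Fin (2 * n)) (Fin (2 * n)) ℂ :=
  covariantDeriv (fun i ↦ (christoffelCoord g p y i).map Complex.ofRealHom) (coordGrad u p y)
    fun i ↦ partialDeriv n i (coordGrad u p) y

lemma hessian_isSymm (g : Metric n M) {u : M → ℂ} (hu : Smooth n u) {p : M} {y : ℝ²ⁿ}
    (hy : y ∈ (φ p).target) : (hessian g u p y).IsSymm := by
  refine IsSymm.ext fun i j ↦ ?_
  simp only [hessian, covariantDeriv, of_apply, Pi.sub_apply, vecMul, dotProduct, map_apply,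
    christoffelCoord_apply g hy, christoffel_symm g p _ j i,
    partialDeriv_coordGrad_comm hu hy j i]

lemma laplacian_eq_neg_trace_hessian (g : Metric n M) {u : M → ℂ} (hu : Smooth n u) (p : M) :
    laplacian g u p =
      -((metricCoord g p (φ p p))⁻¹.map Complex.ofRealHom * hessian g u p (φ p p)).trace := by
  have hy : φ p p ∈ (φ p).target := mem_extChartAt_target p
  have hpos := (metricCoord_posDef g hy).det_pos
  have hsqrt : (√(metricCoord g p (φ p p)).det : ℂ) ≠ 0 :=
    Complex.ofReal_ne_zero.2 (Real.sqrt_pos.2 hpos).ne'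
  have hdiv := sum_fderivWithin_sqrt_det_mul_inv (differentiableWithinAt_metricCoord g hy)
    (metricCoord_isSymm g p _) ((𝓡∂ (2 * n)).uniqueDiffOn _ (extChartAt_target_subset_range p hy))
    hpos (stdVec n) (differentiableWithinAt_coordGrad hu hy)
  rw [laplacian, Complex.ofReal_inv, neg_mul, neg_inj]
  exact (congrArg (_ * ·) hdiv).trans (inv_mul_cancel_left₀ hsqrt _)

/-- `(∇ᵢ du) ∘ J = ∇ᵢ (du ∘ J)` since `∇J = 0`, so `∇ᵢ du` is of type `(1, 0)` like `du`. -/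
lemma IsKahler.hessian_mul_complexMatrix {S : ComplexStructure n M} {g : Metric n M}
    (hg : IsKahler S g) {u : M → ℂ} (hu : u ∈ S.holomorphicFunctions) (p : M) :
    hessian g u p (φ p p) * (complexMatrix S p (φ p p)).map Complex.ofRealHom =
      Complex.I • hessian g u p (φ p p) := by
  have hy : φ p p ∈ (φ p).target := mem_extChartAt_target p
  have hyI := extChartAt_target_subset_range p hy
  have hunique := (𝓡∂ (2 * n)).uniqueDiffOn _ hyI
  have hCR : (fun y ↦ coordGrad u p y ᵥ* (complexMatrix S p y).map Complex.ofRealHom)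
      =ᶠ[𝓝[range (𝓡∂ (2 * n))] (φ p p)] Complex.I • coordGrad u p :=
    Filter.mem_of_superset (extChartAt_target_mem_nhdsWithin_of_mem hy) fun y hy ↦
      ComplexStructure.coordGrad_vecMul_complexMatrix_eq_I_smul hu hy
  refine Matrix.ext_row fun i ↦ covariantDeriv_vecMul
    (dC := (partialDeriv n i (complexMatrix S p) (φ p p)).map Complex.ofRealHom) ?_
    (ComplexStructure.coordGrad_vecMul_complexMatrix_eq_I_smul hu hy) ?_
  · have hparallel := congrArg Complex.ofRealHom.mapMatrix (hg.partialDeriv_complexMatrix p i)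
    rwa [map_sub, map_add, map_mul, map_mul, map_zero] at hparallel
  · have hdiff := congrArg (fun L : ℝ²ⁿ →L[ℝ] (Fin (2 * n) → ℂ) ↦ L (stdVec n i))
      (hCR.fderivWithin_eq_of_mem (𝕜 := ℝ) hyI)
    rw [fderivWithin_const_smul hunique (differentiableWithinAt_coordGrad hu.1 hy)] at hdiff
    exact (fderivWithin_vecMul_map_ofReal (differentiableWithinAt_complexMatrix S hy)
      (differentiableWithinAt_coordGrad hu.1 hy) hunique (stdVec n i)).symm.trans hdiff

theorem IsKahler.laplacian_eq_zero {S : ComplexStructure n M} {g : Metric n M}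
    (hg : IsKahler S g) {u : M → ℂ} (hu : u ∈ S.holomorphicFunctions) (p : M) :
    laplacian g u p = 0 := by
  have hy : φ p p ∈ (φ p).target := mem_extChartAt_target p
  have hinv := mul_inv_mul_transpose_eq_inv (metricCoord_posDef g hy).det_pos.ne'.isUnit
    (hg.transpose_complexMatrix_mul_metricCoord_mul hy)
  rw [laplacian_eq_neg_trace_hessian g hu.1, neg_eq_zero]
  refine trace_mul_eq_zero_of_mul_eq_smul Complex.I_mul_I ?_ (hessian_isSymm g hu.1 hy)
    (hg.hessian_mul_complexMatrix hu p)
  have hinvC := congrArg Complex.ofRealHom.mapMatrix hinv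
  rwa [map_mul, map_mul] at hinvC

omit [IsManifold (𝓡∂ (2 * n)) ∞ M] in
lemma partialDeriv_conj (i : Fin (2 * n)) (v : ℝ²ⁿ → ℂ) {y : ℝ²ⁿ}
    (hy : y ∈ range (𝓡∂ (2 * n))) :
    partialDeriv n i (fun x ↦ (starRingEnd ℂ) (v x)) y =
      (starRingEnd ℂ) (partialDeriv n i v y) :=
  congrArg (· (stdVec n i))
    (Complex.conjCLE.comp_fderivWithin (f := v) ((𝓡∂ (2 * n)).uniqueDiffOn y hy))

lemma laplacian_conj (g : Metric n M) (u : M → ℂ) (p : M) :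
    laplacian g (fun x ↦ (starRingEnd ℂ) (u x)) p = (starRingEnd ℂ) (laplacian g u p) := by
  have hy := extChartAt_target_subset_range (I := 𝓡∂ (2 * n)) p (mem_extChartAt_target p)
  simp only [laplacian, map_mul, map_neg, map_sum, Complex.conj_ofReal]
  congr 1
  refine Finset.sum_congr rfl fun i _ ↦ Finset.sum_congr rfl fun j _ ↦ ?_
  rw [← partialDeriv_conj i _ hy]
  refine congrArg (fun L : ℝ²ⁿ →L[ℝ] ℂ ↦ L (stdVec n i)) (fderivWithin_congr' (fun y hy ↦ ?_) hy)
  rw [map_mul, Complex.conj_ofReal, ← partialDeriv_conj j _ hy]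

end Harmonic

section MeasurableCharts

variable {𝕜 E H M : Type*} [NontriviallyNormedField 𝕜] [NormedAddCommGroup E] [NormedSpace 𝕜 E]
  [MeasurableSpace E] [BorelSpace E] [TopologicalSpace H] {I : ModelWithCorners 𝕜 E H}
  [TopologicalSpace M] [ChartedSpace H M]

lemma measurableSet_extChartAt_target (p : M) : MeasurableSet (extChartAt I p).target := by
  rw [extChartAt_target]
  exact ((chartAt H p).open_target.preimage I.continuous_symm).measurableSet.inter
    I.isClosed_range.measurableSet

lemma measurableSet_extChartAt_image [MeasurableSpace M] [BorelSpace M] {p : M} {A : Set M}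
    (hA : MeasurableSet A) (hAp : A ⊆ (extChartAt I p).source) :
    MeasurableSet (extChartAt I p '' A) := by
  rw [(extChartAt I p).image_eq_target_inter_inv_preimage hAp, ← Subtype.image_preimage_coe]
  exact (measurableSet_extChartAt_target p).subtype_image
    ((continuousOn_extChartAt_symm p).domRestrict.measurable hA)

end MeasurableCharts

lemma measure_pos_of_mem_nhdsWithin {X : Type*} [TopologicalSpace X] [MeasurableSpace X]
    {μ : Measure X} [μ.IsOpenPosMeasure] {s t : Set X} {x : X} (hx : x ∈ closure (interior s))
    (ht : t ∈ 𝓝[s] x) : 0 < μ t := by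
  obtain ⟨U, hU, hxU, hUt⟩ := mem_nhdsWithin.1 ht
  have hne : (U ∩ interior s).Nonempty := mem_closure_iff.1 hx U hU hxU
  exact ((hU.inter isOpen_interior).measure_pos μ hne).trans_le
    (measure_mono fun y hy ↦ hUt ⟨hy.1, interior_subset hy.2⟩)

section Volume

open Matrix

variable {n : ℕ} [NeZero n] {M : Type*} [TopologicalSpace M]
  [ChartedSpace (EuclideanHalfSpace (2 * n)) M] [IsManifold (𝓡∂ (2 * n)) ∞ M]
  {p q x : M}

local notation "ℝ²ⁿ" => EuclideanSpace ℝ (Fin (2 * n))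
local notation "φ" => extChartAt (𝓡∂ (2 * n))

lemma inner_sum_smul_coordFrame (g : Metric n M) (hx : x ∈ (φ p).source)
    (v w : Fin (2 * n) → ℝ) :
    g.inner x (∑ i, v i • coordFrame p i x) (∑ j, w j • coordFrame p j x) =
      v ⬝ᵥ metricCoord g p (φ p x) *ᵥ w := by
  have h := inner_sum_smul_coordVec g p (φ p x) v w
  simp only [coordVec_eq_coordFrame ((φ p).map_source hx)] at h
  rwa [(φ p).left_inv hx] at h

lemma metricCoord_extChartAt_apply (g : Metric n M) (hx : x ∈ (φ p).source)
    (i j : Fin (2 * n)) :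
    metricCoord g p (φ p x) i j = g.inner x (coordFrame p i x) (coordFrame p j x) := by
  simp only [metricCoord, of_apply, coordVec_eq_coordFrame ((φ p).map_source hx)]
  rw [(φ p).left_inv hx]

lemma sum_differential_extChartAt_smul_coordFrame (hx : x ∈ (φ p).source)
    (v : TangentSpace (𝓡∂ (2 * n)) x) :
    ∑ k, differential (F := ℝ²ⁿ) (φ p) x v k • coordFrame p k x = v := by
  have h := sum_differential_extChartAt_smul_coordVec ((φ p).map_source hx)
  simp only [coordVec_eq_coordFrame ((φ p).map_source hx)] at h
  rw [(φ p).left_inv hx] at h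
  exact h v

lemma differential_extChartAt_coordFrame (hq : x ∈ (φ q).source) (hp : x ∈ (φ p).source)
    (j : Fin (2 * n)) :
    differential (φ p) x (coordFrame q j x) =
      tangentCoordChange (𝓡∂ (2 * n)) q p x (stdVec n j) := by
  have hy := (φ q).map_source hq
  have hdiff : MDifferentiableAt (𝓡∂ (2 * n)) 𝓘(ℝ, ℝ²ⁿ) (φ p) ((φ q).symm (φ q x)) := by
    rw [(φ q).left_inv hq]
    exact mdifferentiableAt_extChartAt (extChartAt_source (𝓡∂ (2 * n)) p ▸ hp)
  have hcomp := mfderiv_comp_mfderivWithin (I := 𝓘(ℝ, ℝ²ⁿ)) (φ q x) hdiff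
    (mdifferentiableWithinAt_extChartAt_symm hy)
    ((𝓡∂ (2 * n)).uniqueMDiffOn _ (extChartAt_target_subset_range q hy))
  rw [mfderivWithin_eq_fderivWithin] at hcomp
  have h : differential (φ p) ((φ q).symm (φ q x)) (coordVec q (φ q x) j) =
      tangentCoordChange (𝓡∂ (2 * n)) q p x (stdVec n j) :=
    (congrArg (fun L : ℝ²ⁿ →L[ℝ] ℝ²ⁿ ↦ L (stdVec n j)) hcomp).symm
  rwa [coordVec_eq_coordFrame hy, (φ q).left_inv hq] at h

/-- The matrix, at `x`, of the derivative of the change from the preferred chart around `q` to the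
preferred chart around `p`. -/
def jacobianMatrix (q p x : M) : Matrix (Fin (2 * n)) (Fin (2 * n)) ℝ :=
  of fun i j ↦ tangentCoordChange (𝓡∂ (2 * n)) q p x (stdVec n j) i

lemma det_jacobianMatrix :
    (jacobianMatrix (n := n) q p x).det = (tangentCoordChange (𝓡∂ (2 * n)) q p x).det := by
  rw [ContinuousLinearMap.det,
    ← LinearMap.det_toMatrix (EuclideanSpace.basisFun (Fin (2 * n)) ℝ).toBasis]
  congr 1

lemma coordFrame_eq_sum_jacobianMatrix (hq : x ∈ (φ q).source) (hp : x ∈ (φ p).source)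
    (j : Fin (2 * n)) :
    coordFrame q j x = ∑ k, jacobianMatrix (n := n) q p x k j • coordFrame p k x := by
  rw [← sum_differential_extChartAt_smul_coordFrame hp (coordFrame q j x),
    differential_extChartAt_coordFrame hq hp]
  rfl

lemma metricCoord_eq_transpose_mul_mul (g : Metric n M) (hq : x ∈ (φ q).source)
    (hp : x ∈ (φ p).source) :
    metricCoord g q (φ q x) = (jacobianMatrix q p x)ᵀ * metricCoord g p (φ p x) *
      jacobianMatrix q p x := by
  ext i j
  rw [metricCoord_extChartAt_apply g hq, coordFrame_eq_sum_jacobianMatrix hq hp,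
    coordFrame_eq_sum_jacobianMatrix hq hp, inner_sum_smul_coordFrame g hp, mul_assoc]
  rfl

lemma sqrt_det_metricCoord_eq_abs_det_mul (g : Metric n M) (hq : x ∈ (φ q).source)
    (hp : x ∈ (φ p).source) :
    √(metricCoord g q (φ q x)).det =
      |(tangentCoordChange (𝓡∂ (2 * n)) q p x).det| * √(metricCoord g p (φ p x)).det := by
  rw [metricCoord_eq_transpose_mul_mul g hq hp, det_mul, det_mul, det_transpose,
    mul_right_comm, ← sq, Real.sqrt_mul (sq_nonneg _), Real.sqrt_sq_eq_abs, det_jacobianMatrix]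

lemma continuousOn_sqrt_det_metricCoord (g : Metric n M) (p : M) :
    ContinuousOn (fun y ↦ √(metricCoord g p y).det) (φ p).target :=
  (differentiable_det.continuous.comp_continuousOn fun _ hy ↦
    (differentiableWithinAt_metricCoord g hy).continuousWithinAt.mono
      (extChartAt_target_subset_range p)).sqrt

variable [MeasurableSpace M] [BorelSpace M]

lemma chartVolume_apply (g : Metric n M) (p : M) {A : Set M} (hA : MeasurableSet A) :
    chartVolume g p A =
      ∫⁻ y in (φ p).target ∩ (φ p).symm ⁻¹' A, ENNReal.ofReal √(metricCoord g p y).det := by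
  have hm := measurableSet_extChartAt_target (I := 𝓡∂ (2 * n)) p
  have hsymm : AEMeasurable (φ p).symm ((volume : Measure ℝ²ⁿ).restrict (φ p).target) :=
    (continuousOn_extChartAt_symm p).aemeasurable hm
  rw [chartVolume, Measure.map_apply_of_aemeasurable
    (hsymm.mono_ac (withDensity_absolutelyContinuous _ _)) hA, withDensity_apply',
    Measure.restrict_restrict' hm, inter_comm]

lemma chartVolume_eq_lintegral_image (g : Metric n M) {A : Set M} (hA : MeasurableSet A)
    (hp : A ⊆ (φ p).source) :
    chartVolume g p A = ∫⁻ y in φ p '' A, ENNReal.ofReal √(metricCoord g p y).det := by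
  rw [chartVolume_apply g p hA, (φ p).image_eq_target_inter_inv_preimage hp]

lemma chartVolume_source_compl (g : Metric n M) (p : M) :
    chartVolume g p (φ p).sourceᶜ = 0 := by
  have hempty : (φ p).target ∩ (φ p).symm ⁻¹' (φ p).sourceᶜ = ∅ :=
    disjoint_iff_inter_eq_empty.1 <| disjoint_left.2 fun y hy hyc ↦ hyc ((φ p).map_target hy)
  rw [chartVolume_apply g p (isOpen_extChartAt_source p).measurableSet.compl, hempty,
    Measure.restrict_empty, lintegral_zero_measure]

lemma chartVolume_eq_chartVolume (g : Metric n M) {A : Set M} (hA : MeasurableSet A)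
    (hp : A ⊆ (φ p).source) (hq : A ⊆ (φ q).source) : chartVolume g p A = chartVolume g q A := by
  have himage : φ p '' A = (φ p ∘ (φ q).symm) '' (φ q '' A) := by
    rw [image_comp, (φ q).symm_image_image_of_subset_source hq]
  have hinj : InjOn (φ p ∘ (φ q).symm) (φ q '' A) := by
    rintro _ ⟨x, hx, rfl⟩ _ ⟨z, hz, rfl⟩ h
    simp only [Function.comp_apply, (φ q).left_inv (hq hx), (φ q).left_inv (hq hz)] at h
    rw [(φ p).injOn (hp hx) (hp hz) h]
  have hderiv : ∀ y ∈ φ q '' A, HasFDerivWithinAt (φ p ∘ (φ q).symm)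
      (tangentCoordChange (𝓡∂ (2 * n)) q p ((φ q).symm y)) (φ q '' A) y := by
    rintro _ ⟨x, hx, rfl⟩
    rw [(φ q).left_inv (hq hx)]
    exact (hasFDerivWithinAt_tangentCoordChange ⟨hq hx, hp hx⟩).mono
      (image_subset_iff.2 fun z hz ↦
        extChartAt_target_subset_range q ((φ q).map_source (hq hz)))
  have himage_meas := measurableSet_extChartAt_image hA hq
  rw [chartVolume_eq_lintegral_image g hA hp, chartVolume_eq_lintegral_image g hA hq, himage,
    lintegral_image_eq_lintegral_abs_det_fderiv_mul volume himage_meas hderiv hinj]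
  refine setLIntegral_congr_fun himage_meas ?_
  rintro _ ⟨x, hx, rfl⟩
  simp only [Function.comp_apply, (φ q).left_inv (hq hx)]
  rw [← ENNReal.ofReal_mul (abs_nonneg _), sqrt_det_metricCoord_eq_abs_det_mul g (hq hx) (hp hx)]

lemma riemannianVolume_eq_chartVolume (g : Metric n M) {A : Set M} (hA : MeasurableSet A)
    (hp : A ⊆ (φ p).source) : riemannianVolume g A = chartVolume g p A := by
  refine le_antisymm ?_ (Measure.le_iff'.1 (le_iSup (chartVolume g) p) A)
  have hsource (q : M) : MeasurableSet (φ q).source := (isOpen_extChartAt_source q).measurableSet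
  let ν := chartVolume g p + (riemannianVolume g).restrict (φ p).sourceᶜ
  have hle : riemannianVolume g ≤ ν := iSup_le fun q ↦ Measure.le_iff.2 fun B hB ↦ by
    have hinside : chartVolume g q (B ∩ (φ p).source) ≤ chartVolume g p B := calc
      _ = chartVolume g q (B ∩ (φ p).source ∩ (φ q).source) :=
        (measure_inter_conull (chartVolume_source_compl g q)).symm
      _ = chartVolume g p (B ∩ (φ p).source ∩ (φ q).source) :=
        chartVolume_eq_chartVolume g ((hB.inter (hsource p)).inter (hsource q))
          inter_subset_right (inter_subset_left.trans inter_subset_right)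
      _ ≤ chartVolume g p B := measure_mono (inter_subset_left.trans inter_subset_left)
    have houtside : chartVolume g q (B \ (φ p).source) ≤
        (riemannianVolume g).restrict (φ p).sourceᶜ B := by
      rw [Measure.restrict_apply hB]
      exact Measure.le_iff'.1 (le_iSup (chartVolume g) q) _
    rw [← measure_inter_add_sdiff B (hsource p)]
    exact add_le_add hinside houtside
  calc riemannianVolume g A ≤ ν A := hle A
    _ = chartVolume g p A := by
      rw [Measure.add_apply, Measure.restrict_apply hA,
        disjoint_iff_inter_eq_empty.1 (disjoint_compl_right.mono_left hp), measure_empty, add_zero]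

instance isLocallyFiniteMeasure_riemannianVolume (g : Metric n M) :
    IsLocallyFiniteMeasure (riemannianVolume g) := by
  refine ⟨fun x ↦ ?_⟩
  obtain ⟨s, hs, hint⟩ := (continuousOn_sqrt_det_metricCoord g x).integrableAt_nhdsWithin
    (μ := volume) (measurableSet_extChartAt_target x) (mem_extChartAt_target x)
  rw [nhdsWithin_extChartAt_target_eq, ← map_extChartAt_nhds] at hs
  obtain ⟨U, hU, hUo, hxU⟩ := mem_nhds_iff.1
    (Filter.inter_mem hs (extChartAt_source_mem_nhds (I := 𝓡∂ (2 * n)) x))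
  refine ⟨U, hUo.mem_nhds hxU, ?_⟩
  have hsource := hU.trans inter_subset_right
  rw [riemannianVolume_eq_chartVolume g hUo.measurableSet hsource,
    chartVolume_eq_lintegral_image g hUo.measurableSet hsource]
  exact (lintegral_mono_set (image_subset_iff.2 (hU.trans inter_subset_left))).trans_lt
    hint.setLIntegral_lt_top

lemma chartVolume_ne_zero_of_mem_nhds (g : Metric n M) {A : Set M} (hA : MeasurableSet A)
    (hp : A ∈ 𝓝 p) (hsource : A ⊆ (φ p).source) : chartVolume g p A ≠ 0 := by
  have hmeas := measurableSet_extChartAt_image hA hsource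
  have htarget : φ p '' A ⊆ (φ p).target :=
    (image_mono hsource).trans (φ p).image_source_eq_target.le
  have hvol : 0 < volume (φ p '' A) := by
    refine measure_pos_of_mem_nhdsWithin ((𝓡∂ (2 * n)).range_subset_closure_interior
      (extChartAt_target_subset_range p (mem_extChartAt_target p))) ?_
    rw [← map_extChartAt_nhds]
    exact Filter.image_mem_map hp
  rw [chartVolume_eq_lintegral_image g hA hsource]
  refine fun hzero ↦ hvol.ne' ?_
  rw [lintegral_eq_zero_iff' (((continuousOn_sqrt_det_metricCoord g p).mono htarget).aemeasurable
    hmeas).ennreal_ofReal] at hzero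
  rw [← Measure.restrict_eq_zero, ← ae_eq_bot]
  refine Filter.eventually_false_iff_eq_bot.1 ?_
  filter_upwards [hzero, ae_restrict_mem hmeas] with y hy hyA
  exact (Real.sqrt_pos.2 (metricCoord_posDef g (htarget hyA)).det_pos).not_ge
    (ENNReal.ofReal_eq_zero.1 hy)

instance isOpenPosMeasure_riemannianVolume (g : Metric n M) :
    (riemannianVolume g).IsOpenPosMeasure := by
  refine ⟨fun U hU ⟨x, hx⟩ hzero ↦ ?_⟩
  have hsource : U ∩ (φ x).source ⊆ (φ x).source := inter_subset_right
  have hopen := hU.inter (isOpen_extChartAt_source (I := 𝓡∂ (2 * n)) x)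
  refine chartVolume_ne_zero_of_mem_nhds g hopen.measurableSet
    (hopen.mem_nhds ⟨hx, mem_extChartAt_source x⟩) hsource ?_
  rw [← riemannianVolume_eq_chartVolume g hopen.measurableSet hsource]
  exact measure_mono_null inter_subset_left hzero

end Volume

section Density

variable {X 𝕜 : Type*} [TopologicalSpace X] [CompactSpace X] [RCLike 𝕜]

lemma clm_eq_zero_of_subalgebra_mul_star {A : Subalgebra 𝕜 C(X, 𝕜)}
    (hA : A.SeparatesPoints) {F : Type*} [NormedAddCommGroup F] [NormedSpace 𝕜 F]
    (L : C(X, 𝕜) →L[𝕜] F) (hL : ∀ u ∈ A, ∀ v ∈ A, L (u * star v) = 0) : L = 0 := by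
  have hker : A.starClosure.toSubalgebra.toSubmodule ≤ LinearMap.ker (L : C(X, 𝕜) →ₗ[𝕜] F) := by
    rw [Subalgebra.starClosure_toSubalgebra, ← Subalgebra.mul_toSubmodule]
    refine Submodule.mul_le.2 fun u hu v hv ↦ ?_
    rw [← star_star v]
    exact hL u hu _ ((Subalgebra.mem_star_iff _ _).1 hv)
  have hdense := ContinuousMap.starSubalgebra_topologicalClosure_eq_top_of_separatesPoints
    A.starClosure (Subalgebra.separatesPoints_monotone le_sup_left hA)
  have hclosure : (A.starClosure.topologicalClosure : Set C(X, 𝕜)) ⊆ {u | L u = 0} :=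
    closure_minimal hker (isClosed_eq L.continuous continuous_const)
  rw [hdense] at hclosure
  exact ContinuousLinearMap.ext fun u ↦ hclosure (mem_univ u)

open scoped ComplexConjugate in
lemma eq_zero_of_integral_mul_conj_eq_zero [MeasurableSpace X] [BorelSpace X] {μ : Measure X}
    [IsFiniteMeasure μ] [μ.IsOpenPosMeasure] {A : Subalgebra 𝕜 C(X, 𝕜)}
    (hA : A.SeparatesPoints) (f : C(X, 𝕜))
    (hf : ∀ u ∈ A, ∀ v ∈ A, ∫ x, f x * u x * conj (v x) ∂μ = 0) : f = 0 := by
  let T : C(X, 𝕜) →L[𝕜] Lp 𝕜 2 μ := ContinuousMap.toLp 2 μ 𝕜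
  have hT (u : C(X, 𝕜)) : inner 𝕜 (T (star f)) (T u) = ∫ x, f x * u x ∂μ := by
    rw [ContinuousMap.inner_toLp]
    simp [mul_comm]
  have hzero : innerSL 𝕜 (T (star f)) ∘L T = 0 :=
    clm_eq_zero_of_subalgebra_mul_star hA _ fun u hu v hv ↦ by
      refine (hT _).trans ?_
      simpa [mul_assoc] using hf u hu v hv
  have hnorm : T (star f) = 0 := inner_self_eq_zero.1 (DFunLike.congr_fun hzero (star f))
  exact star_eq_zero.1 (ContinuousMap.toLp_injective μ (hnorm.trans (map_zero T).symm))

end Density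

section HolomorphicFunctions

variable {n : ℕ} [NeZero n] {M : Type*} [TopologicalSpace M]
  [ChartedSpace (EuclideanHalfSpace (2 * n)) M]

lemma Smooth.conj {u : M → ℂ} (hu : Smooth n u) : Smooth n fun x ↦ starRingEnd ℂ (u x) :=
  Complex.conjCLE.contDiff.comp_contMDiff hu

lemma Smooth.hasMFDerivAt {u : M → ℂ} (hu : Smooth n u) (p : M) :
    HasMFDerivAt (𝓡∂ (2 * n)) 𝓘(ℝ, ℂ) u p (differential u p) :=
  (hu.mdifferentiable (by simp) p).hasMFDerivAt

variable [IsManifold (𝓡∂ (2 * n)) ∞ M]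

/-- The algebra `𝒪(M)` as a subalgebra of the algebra of continuous functions. -/
def ComplexStructure.holomorphicSubalgebra (S : ComplexStructure n M) : Subalgebra ℂ C(M, ℂ) where
  carrier := {u | ⇑u ∈ S.holomorphicFunctions}
  mul_mem' {u v} hu hv := by
    refine ⟨contDiff_mul.comp_contMDiff (hu.1.prodMk_space hv.1), fun p hp w ↦ ?_⟩
    have h (w) := congrArg (fun L : TangentSpace (𝓡∂ (2 * n)) p →L[ℝ] ℂ ↦ L w)
      ((hu.1.hasMFDerivAt p).mul (hv.1.hasMFDerivAt p)).mfderiv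
    refine (h _).trans (Eq.trans ?_ (congrArg (Complex.I * ·) (h w)).symm)
    change u p * differential v p (S.J p w) + v p * differential u p (S.J p w) =
      Complex.I * (u p * differential v p w + v p * differential u p w)
    rw [hu.2 p hp, hv.2 p hp]
    ring
  add_mem' {u v} hu hv := by
    refine ⟨ContMDiff.add hu.1 hv.1, fun p hp w ↦ ?_⟩
    have h (w) := congrArg (fun L : TangentSpace (𝓡∂ (2 * n)) p →L[ℝ] ℂ ↦ L w)
      ((hu.1.hasMFDerivAt p).add (hv.1.hasMFDerivAt p)).mfderiv
    refine (h _).trans (Eq.trans ?_ (congrArg (Complex.I * ·) (h w)).symm)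
    change differential u p (S.J p w) + differential v p (S.J p w) =
      Complex.I * (differential u p w + differential v p w)
    rw [hu.2 p hp, hv.2 p hp, mul_add]
  algebraMap_mem' c := by
    refine ⟨contMDiff_const, fun p _ v ↦ ?_⟩
    have h : differential (n := n) (fun _ : M ↦ c) p = 0 := mfderiv_const
    change differential (n := n) (fun _ : M ↦ c) p _ = Complex.I * differential (fun _ ↦ c) p _
    simp [h]

lemma ComplexStructure.HolomorphicallySeparable.separatesPoints {S : ComplexStructure n M}
    (hS : S.HolomorphicallySeparable) : S.holomorphicSubalgebra.SeparatesPoints := fun x y hxy ↦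
  let ⟨u, hu, hne⟩ := hS x y hxy
  ⟨u, ⟨⟨u, hu.1.continuous⟩, hu, rfl⟩, hne⟩

end HolomorphicFunctions

end KahlerCalderon

theorem mainTheorem1_general (n : ℕ) [NeZero n] (M : Type*) [TopologicalSpace M]
    [CompactSpace M] [ChartedSpace (EuclideanHalfSpace (2 * n)) M]
    [IsManifold (𝓡∂ (2 * n)) ∞ M] [MeasurableSpace M] [BorelSpace M]
    (S : KahlerCalderon.ComplexStructure n M) (hsep : S.HolomorphicallySeparable)
    (g : KahlerCalderon.Metric n M) (hg : KahlerCalderon.IsKahler S g)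
    (f : M → ℂ) (hf : Continuous f)
    (horth : ∀ u₁ u₂ : M → ℂ, KahlerCalderon.Smooth n u₁ → KahlerCalderon.Smooth n u₂ →
      (∀ p, KahlerCalderon.laplacian g u₁ p = 0) →
      (∀ p, KahlerCalderon.laplacian g u₂ p = 0) →
      ∫ x, f x * u₁ x * u₂ x ∂(KahlerCalderon.riemannianVolume g) = 0) :
    ∀ x, f x = 0 := by
  have horth_conj : ∀ u ∈ S.holomorphicSubalgebra, ∀ v ∈ S.holomorphicSubalgebra,
      ∫ x, f x * u x * starRingEnd ℂ (v x) ∂(KahlerCalderon.riemannianVolume g) = 0 := by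
    refine fun u hu v hv ↦ horth _ _ hu.1 hv.1.conj (hg.laplacian_eq_zero hu) fun p ↦ ?_
    rw [KahlerCalderon.laplacian_conj, hg.laplacian_eq_zero hv, map_zero]
  exact DFunLike.congr_fun <| KahlerCalderon.eq_zero_of_integral_mul_conj_eq_zero
    hsep.separatesPoints ⟨f, hf⟩ horth_conj

end

theorem mainTheorem1 (n : ℕ) [NeZero n] (M : Type*) [TopologicalSpace M] [T2Space M]
    [CompactSpace M] [ChartedSpace (EuclideanHalfSpace (2 * n)) M]
    [IsManifold (𝓡∂ (2 * n)) ∞ M] [MeasurableSpace M] [BorelSpace M]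
    (S : KahlerCalderon.ComplexStructure n M)
    (hsep : S.HolomorphicallySeparable) (hchart : S.HasGlobalHolomorphicCharts)
    (g : KahlerCalderon.Metric n M) (hg : KahlerCalderon.IsKahler S g)
    (f : M → ℂ) (hf : KahlerCalderon.Smooth n f)
    (hf_bdry : KahlerCalderon.VanishesToInfiniteOrderAtBoundary n f)
    (horth : ∀ u₁ u₂ : M → ℂ, KahlerCalderon.Smooth n u₁ → KahlerCalderon.Smooth n u₂ →
      (∀ p, KahlerCalderon.laplacian g u₁ p = 0) →
      (∀ p, KahlerCalderon.laplacian g u₂ p = 0) →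
      ∫ x, f x * u₁ x * u₂ x ∂(KahlerCalderon.riemannianVolume g) = 0) :
    ∀ x, f x = 0 :=
  mainTheorem1_general n M S hsep g hg f hf.continuous horth
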